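/- Let $K$ be a nonarchimedean local field, let $B$ be a finite-dimensional central division algebra over $K$, and let $\rho$ be the absolute value on $B$ extending that of $K$, that is, $\rho(x)=|N_{B/K}(x)|^{1/[B:K]}$. Every $K$-subalgebra $S$ of $B$ is a division algebra; write $\mathcal{O}_S=\{x\in S:\rho(x)\le 1\}$ for its ring of integers, $\mathfrak{m}_S=\{x\in S:\rho(x)<1\}$ for the maximal ideal of $\mathcal{O}_S$, $\pi_S$ for a generator of $\mathfrak{m}_S$ (a uniformizing parameter), and $\mathbb{S}=\mathcal{O}_S/\mathfrak{m}_S$ for the residue field. For $K$-subalgebras $T\subseteq S$ of $B$, let the residual degree be $f(S/T)=[\mathbb{S}:\mathbb{T}]$ and the ramification index be $e(S/T)=\log_{\rho(\pi_S)}\rho(\pi_T)$. If $L$ is any $K$-subalgebra of $B$ and $C$ is the centralizer of $L$ in $B$, then $$e(L/K)=f(B/C),\qquad f(L/K)=e(B/C).$$ -/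

import Mathlib

/-!
Throughout, `K` is a nonarchimedean local field: a locally compact field with a nontrivial
ultrametric absolute value.  `B` is a finite-dimensional division algebra over `K`, and all
the division algebras `K ⊆ T ⊆ S ⊆ B` are `K`-subalgebras of `B`, with `⊥` for `K` and `⊤` for `B`.
-/

namespace LocalDivisionAlgebra

/-- The absolute value `ρ(x) = |N_{B/K}(x)| ^ (1 / [B : K])` of `B`; it extends that of `K`. -/
noncomputable def absVal (K : Type*) {B : Type*} [NontriviallyNormedField K]
    [DivisionRing B] [Algebra K B] (x : B) : ℝ :=
  ‖Algebra.norm K x‖ ^ (1 / (Module.finrank K B : ℝ))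

section AbsVal

variable {K : Type*} [NontriviallyNormedField K]
variable {B : Type*} [DivisionRing B] [Algebra K B]

theorem absVal_nonneg (x : B) : 0 ≤ absVal K x := Real.rpow_nonneg (norm_nonneg _) _

theorem absVal_one : absVal K (1 : B) = 1 := by simp [absVal]

theorem absVal_mul (x y : B) : absVal K (x * y) = absVal K x * absVal K y := by
  simp [absVal, Real.mul_rpow]

theorem absVal_inv {x : B} (hx : x ≠ 0) : absVal K x * absVal K x⁻¹ = 1 := by
  rw [← absVal_mul, mul_inv_cancel₀ hx, absVal_one]

theorem absVal_pos {x : B} (hx : x ≠ 0) : 0 < absVal K x := by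
  refine (absVal_nonneg x).lt_of_ne fun h => ?_
  have := absVal_inv (K := K) hx
  simp [← h] at this

/-- The norm of an element that lies in the image of a field extension of `K`. -/
theorem norm_of_field {E : Type*} [Field E] [Algebra K E] [FiniteDimensional K E]
    (φ : E →ₐ[K] B) (e : E) :
    ∃ m : ℕ, Module.finrank K B = Module.finrank K E * m ∧
      Algebra.norm K (φ e) = Algebra.norm K e ^ m := by
  let _ : Module E B := Module.compHom B φ.toRingHom
  have hsm : ∀ (a : E) (b : B), a • b = φ a * b := fun _ _ => rfl
  have : IsScalarTower K E B := ⟨fun k a b => by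
    rw [hsm, hsm, map_smul, smul_mul_assoc]⟩
  refine ⟨Module.finrank E B, (Module.finrank_mul_finrank K E B).symm, ?_⟩
  have h := LinearMap.det_restrictScalars (R := K) (S := E) (A := B)
    (f := e • (LinearMap.id : B →ₗ[E] B))
  rw [LinearMap.det_smul, LinearMap.det_id, mul_one, map_pow] at h
  rw [← h, Algebra.norm_apply]
  rfl

variable [FiniteDimensional K B]

theorem absVal_pow_finrank (x : B) :
    absVal K x ^ Module.finrank K B = ‖Algebra.norm K x‖ := by
  have h : (Module.finrank K B : ℝ) ≠ 0 := by
    exact_mod_cast (Module.finrank_pos (R := K) (M := B)).ne'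
  rw [absVal, ← Real.rpow_natCast, ← Real.rpow_mul (norm_nonneg _), one_div_mul_cancel h,
    Real.rpow_one]

theorem absVal_algebraMap (a : K) : absVal K (algebraMap K B a) = ‖a‖ := by
  have h : (Module.finrank K B : ℝ) ≠ 0 := by
    exact_mod_cast (Module.finrank_pos (R := K) (M := B)).ne'
  rw [absVal, Algebra.norm_algebraMap, norm_pow, ← Real.rpow_natCast,
    ← Real.rpow_mul (norm_nonneg _), mul_one_div_cancel h, Real.rpow_one]

theorem absVal_zero : absVal K (0 : B) = 0 := by
  simpa using absVal_algebraMap (B := B) (0 : K)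

theorem absVal_neg (x : B) : absVal K (-x) = absVal K x := by
  have h := absVal_mul (K := K) (-1) x
  have h1 : absVal K (-1 : B) = 1 := by simpa using absVal_algebraMap (B := B) (-1 : K)
  simpa [h1] using h

variable [IsUltrametricDist K] [LocallyCompactSpace K]

theorem absVal_of_generator {E : Type*} [Field E] [Algebra K E] [FiniteDimensional K E]
    (φ : E →ₐ[K] B) (e : E) : absVal K (φ e) = spectralNorm K E e := by
  have : ProperSpace K := ProperSpace.of_locallyCompactSpace K
  let F := IntermediateField.adjoin K {e}
  have hint : IsIntegral K e := Algebra.IsIntegral.isIntegral e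
  obtain ⟨m, hm, hN⟩ := norm_of_field (φ.comp F.val) (IntermediateField.AdjoinSimple.gen K e)
  have hφ : (φ.comp F.val) (IntermediateField.AdjoinSimple.gen K e) = φ e := rfl
  rw [hφ] at hN
  have hfr : Module.finrank K F = (minpoly K e).natDegree :=
    IntermediateField.adjoin.finrank hint
  have hgen := Algebra.PowerBasis.norm_gen_eq_coeff_zero_minpoly
    (IntermediateField.adjoin.powerBasis hint)
  rw [IntermediateField.adjoin.powerBasis_gen, IntermediateField.minpoly_gen] at hgen
  have hpos := Module.finrank_pos (R := K) (M := B)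
  have hm0 : (m : ℝ) ≠ 0 := by
    rintro h
    have : m = 0 := by exact_mod_cast h
    simp [this] at hm
    omega
  rw [absVal, hN, hgen, spectralNorm.spectralNorm_eq_norm_coeff_zero_rpow, hm, hfr]
  simp only [norm_pow, norm_mul, norm_neg, norm_one, one_pow, one_mul]
  rw [← Real.rpow_natCast, ← Real.rpow_mul (norm_nonneg _)]
  congr 1
  push_cast
  by_cases h : ((minpoly K e).natDegree : ℝ) = 0
  · simp [h]
  · field_simp

theorem absVal_one_add_le (x : B) : absVal K (1 + x) ≤ max 1 (absVal K x) := by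
  have hint : IsIntegral K x := Algebra.IsIntegral.isIntegral x
  have : Fact (Irreducible (minpoly K x)) := ⟨minpoly.irreducible hint⟩
  let E := AdjoinRoot (minpoly K x)
  have : FiniteDimensional K E := (AdjoinRoot.powerBasis (minpoly.ne_zero hint)).finite
  obtain ⟨φ, hφ⟩ : ∃ φ : E →ₐ[K] B, φ (AdjoinRoot.root (minpoly K x)) = x := by
    refine ⟨(Ideal.Quotient.liftₐ (Ideal.span {minpoly K x}) (Polynomial.aeval x) ?_), ?_⟩
    · intro a ha
      obtain ⟨b, rfl⟩ := Ideal.mem_span_singleton.1 ha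
      simp
    · exact Polynomial.aeval_X (R := K) x
  have h1 : (1 : B) + x = φ (1 + AdjoinRoot.root (minpoly K x)) := by simp [hφ]
  have hx := absVal_of_generator φ (AdjoinRoot.root (minpoly K x))
  rw [hφ] at hx
  rw [h1, absVal_of_generator, hx]
  refine (isNonarchimedean_spectralNorm (K := K) (L := E) _ _).trans ?_
  rw [spectralNorm_one]

theorem absVal_add_le (x y : B) : absVal K (x + y) ≤ max (absVal K x) (absVal K y) := by
  by_cases hx : x = 0
  · simp [hx]
  have h : x + y = x * (1 + x⁻¹ * y) := by
    rw [mul_add, mul_one, mul_inv_cancel_left₀ hx]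
  have h2 : y = x * (x⁻¹ * y) := by rw [mul_inv_cancel_left₀ hx]
  have h3 : absVal K y = absVal K x * absVal K (x⁻¹ * y) := by rw [← absVal_mul, ← h2]
  rw [h, absVal_mul, h3]
  refine (mul_le_mul_of_nonneg_left (absVal_one_add_le (x⁻¹ * y)) (absVal_nonneg x)).trans ?_
  rw [mul_max_of_nonneg _ _ (absVal_nonneg x), mul_one]

end AbsVal

section Residue

variable {K : Type*} [NontriviallyNormedField K] [IsUltrametricDist K] [LocallyCompactSpace K]
variable {B : Type*} [DivisionRing B] [Algebra K B] [FiniteDimensional K B]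

/-- The ring of integers `{x ∈ S | ρ(x) ≤ 1}` of `S`. -/
noncomputable def integers (S : Subalgebra K B) : Subring B where
  carrier := {x | x ∈ S ∧ absVal K x ≤ 1}
  zero_mem' := ⟨S.zero_mem, by rw [absVal_zero]; exact zero_le_one⟩
  one_mem' := ⟨S.one_mem, absVal_one.le⟩
  add_mem' := fun ha hb => ⟨S.add_mem ha.1 hb.1, (absVal_add_le _ _).trans (max_le ha.2 hb.2)⟩
  neg_mem' := fun ha => ⟨S.neg_mem ha.1, by rw [absVal_neg]; exact ha.2⟩
  mul_mem' := fun ha hb => ⟨S.mul_mem ha.1 hb.1, by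
    rw [absVal_mul]; exact mul_le_one₀ ha.2 (absVal_nonneg _) hb.2⟩

/-- The maximal ideal `{x ∈ S | ρ(x) < 1}` of the ring of integers of `S`. -/
noncomputable def maxIdeal (S : Subalgebra K B) : Ideal (integers S) where
  carrier := {x | absVal K (x : B) < 1}
  zero_mem' := by simp [absVal_zero]
  add_mem' := fun ha hb => (absVal_add_le _ _).trans_lt (max_lt ha hb)
  smul_mem' := fun c x hx => by
    simp only [smul_eq_mul, Set.mem_ofPred_eq, Subring.coe_mul, absVal_mul] at hx ⊢
    exact mul_lt_one_of_nonneg_of_lt_one_right c.2.2 (absVal_nonneg _) hx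

instance maxIdeal_isTwoSided (S : Subalgebra K B) : (maxIdeal S).IsTwoSided where
  mul_mem_of_left := fun {a} b ha => by
    change absVal K ((a * b : integers S) : B) < 1
    rw [Subring.coe_mul, absVal_mul]
    exact mul_lt_one_of_nonneg_of_lt_one_left (absVal_nonneg _) ha b.2.2

/-- The residue field of `S`. -/
abbrev ResidueField (S : Subalgebra K B) : Type _ := integers S ⧸ maxIdeal S

theorem integers_mono {T S : Subalgebra K B} (h : T ≤ S) : integers T ≤ integers S :=
  fun _ hx => ⟨h hx.1, hx.2⟩

/-- The inclusion of the residue field of `T` in that of `S`, for `T ⊆ S`. -/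
noncomputable def residueMap {T S : Subalgebra K B} (h : T ≤ S) :
    ResidueField T →+* ResidueField S :=
  Ideal.Quotient.lift (maxIdeal T)
    ((Ideal.Quotient.mk (maxIdeal S)).comp (Subring.inclusion (integers_mono h)))
    fun a ha => by
      rw [RingHom.comp_apply, Ideal.Quotient.eq_zero_iff_mem]
      exact ha

/-- The residual degree `f(S/T)`: the degree of the extension of residue fields. -/
noncomputable def residualDegree {T S : Subalgebra K B} (h : T ≤ S) : ℕ :=
  letI : Module (ResidueField T) (ResidueField S) := Module.compHom _ (residueMap h)
  Module.finrank (ResidueField T) (ResidueField S)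

/-- `π` is a uniformizing parameter of `S`: it generates the maximal ideal. -/
def IsUniformizer (S : Subalgebra K B) (π : integers S) : Prop :=
  maxIdeal S = Ideal.span {π}


theorem mem_maxIdeal {S : Subalgebra K B} {x : integers S} :
    x ∈ maxIdeal S ↔ absVal K (x : B) < 1 := Iff.rfl

variable (K) in
/-- The absolute value of `K` is discrete. -/
theorem exists_norm_eq_zpow :
    ∃ p : ℝ, 0 < p ∧ p < 1 ∧ ∀ a : K, a ≠ 0 → ∃ j : ℤ, ‖a‖ = p ^ j := by
  have : ProperSpace K := ProperSpace.of_locallyCompactSpace K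
  have hc : IsCompact (Metric.ball (0 : K) 1) :=
    (isCompact_closedBall (0 : K) 1).of_isClosed_subset (IsUltrametricDist.isClosed_ball _ _)
      Metric.ball_subset_closedBall
  obtain ⟨a₀, ha₀, hmax⟩ := hc.exists_isMaxOn ⟨0, by simp⟩ (continuous_norm (E := K)).continuousOn
  obtain ⟨b, hb0, hb1⟩ := NormedField.exists_norm_lt_one K
  have hmax' : ∀ a : K, ‖a‖ < 1 → ‖a‖ ≤ ‖a₀‖ := fun a ha => hmax (by simpa using ha)
  have h0 : 0 < ‖a₀‖ := hb0.trans_le (hmax' b hb1)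
  have h1 : ‖a₀‖ < 1 := by simpa using ha₀
  refine ⟨‖a₀‖, h0, h1, fun a ha => ?_⟩
  obtain ⟨n, hn1, hn2⟩ := exists_mem_Ico_zpow (norm_pos_iff.2 ha) ((one_lt_inv₀ h0).2 h1)
  refine ⟨-n, ?_⟩
  rw [inv_zpow'] at hn1 hn2
  refine le_antisymm ?_ hn1
  have h2 : ‖a * a₀ ^ (n + 1)‖ < 1 := by
    rw [norm_mul, norm_zpow]
    calc ‖a‖ * ‖a₀‖ ^ (n + 1) < ‖a₀‖ ^ (-(n + 1)) * ‖a₀‖ ^ (n + 1) := by gcongr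
      _ = 1 := by rw [← zpow_add₀ h0.ne']; simp
  have h3 := hmax' _ h2
  rw [norm_mul, norm_zpow, zpow_add₀ h0.ne', zpow_one, ← mul_assoc] at h3
  have h4 : ‖a‖ * ‖a₀‖ ^ n ≤ 1 := le_of_mul_le_mul_right (by simpa using h3) h0
  rw [zpow_neg]
  rwa [← one_div, le_div_iff₀ (zpow_pos h0 n)]

theorem exists_isUniformizer (S : Subalgebra K B) : ∃ π : integers S, IsUniformizer S π := by
  classical
  obtain ⟨p, hp0, hp1, hp⟩ := exists_norm_eq_zpow K
  have hd := (Module.finrank_pos (R := K) (M := B)).ne'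
  have hval : ∀ x : B, x ≠ 0 → absVal K x < 1 →
      ∃ j : ℕ, absVal K x ^ Module.finrank K B = p ^ j := by
    intro x hx hx1
    have hne : Algebra.norm K x ≠ 0 := by
      rw [← norm_pos_iff, ← absVal_pow_finrank]
      exact pow_pos (absVal_pos hx) _
    obtain ⟨j, hj⟩ := hp _ hne
    rw [← absVal_pow_finrank] at hj
    have hlt : p ^ j < 1 := hj ▸ pow_lt_one₀ (absVal_nonneg x) hx1 hd
    have hj0 : 0 ≤ j := by
      by_contra! hneg
      exact absurd hlt (not_lt.2 (one_le_zpow_of_nonpos₀ hp0 hp1.le hneg.le))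
    lift j to ℕ using hj0
    exact ⟨j, by simpa using hj⟩
  have hex : ∃ j : ℕ, ∃ x ∈ S, x ≠ 0 ∧ absVal K x < 1 ∧
      absVal K x ^ Module.finrank K B = p ^ j := by
    obtain ⟨b, hb0, hb1⟩ := NormedField.exists_norm_lt_one K
    have hb : algebraMap K B b ≠ 0 := by simpa using norm_pos_iff.1 hb0
    have hb' : absVal K (algebraMap K B b) < 1 := by rwa [absVal_algebraMap]
    obtain ⟨j, hj⟩ := hval _ hb hb'
    exact ⟨j, _, S.algebraMap_mem b, hb, hb', hj⟩
  obtain ⟨π, hπS, hπ0, hπ1, hπj⟩ := Nat.find_spec hex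
  refine ⟨⟨π, hπS, hπ1.le⟩, ?_⟩
  have hinv : π⁻¹ ∈ S := by
    have hinj : Function.Injective (LinearMap.mulLeft K (⟨π, hπS⟩ : S)) := fun a b hab =>
      Subtype.ext (mul_left_cancel₀ hπ0 (congrArg Subtype.val hab))
    obtain ⟨y, hy⟩ := LinearMap.injective_iff_surjective.1 hinj 1
    have hy' : π * (y : B) = 1 := congrArg Subtype.val hy
    rw [inv_eq_of_mul_eq_one_right hy']
    exact y.2
  refine le_antisymm (fun x hx => ?_) ?_
  · rw [Ideal.mem_span_singleton']
    have hxle : absVal K (x : B) ≤ absVal K π := by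
      by_cases hx0 : (x : B) = 0
      · rw [hx0, absVal_zero]
        exact absVal_nonneg _
      obtain ⟨j, hj⟩ := hval x hx0 hx
      have hmin : Nat.find hex ≤ j := Nat.find_min' hex ⟨x, x.2.1, hx0, hx, hj⟩
      refine le_of_pow_le_pow_left₀ hd (absVal_nonneg _) ?_
      rw [hj, hπj]
      exact pow_le_pow_of_le_one hp0.le hp1.le hmin
    refine ⟨⟨x * π⁻¹, S.mul_mem x.2.1 hinv, ?_⟩, Subtype.ext ?_⟩
    · rw [absVal_mul, ← absVal_inv (K := K) hπ0]
      exact mul_le_mul_of_nonneg_right hxle (absVal_nonneg _)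
    · exact inv_mul_cancel_right₀ hπ0 _
  · rw [Ideal.span_le, Set.singleton_subset_iff]
    exact hπ1

/-- A uniformizing parameter `π_S` of `S`; its absolute value does not depend on the choice. -/
noncomputable def uniformizer (S : Subalgebra K B) : integers S :=
  (exists_isUniformizer S).choose

/-- The ramification index `e(S/T) = log_{ρ(π_S)} ρ(π_T)`, for `T ⊆ S`. -/
noncomputable def ramificationIndex {T S : Subalgebra K B} (_h : T ≤ S) : ℝ :=
  Real.logb (absVal K (uniformizer S : B)) (absVal K (uniformizer T : B))

end Residue

end LocalDivisionAlgebra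

/-!
Counting the index of `π 𝒪_S` in `𝒪_S`, for a uniformizing parameter `π` of `K`, gives the
fundamental identity `[S : K] = e(S/K) f(S/K)`. If `Z` is the centre of `S`, a commutative
subalgebra `Z ⊆ F ⊆ S` is contained in its own centralizer, so `[F : Z] ≤ [S : F]`. Taking `F` to
contain a uniformizing parameter of `S` gives `e(S/Z) ≤ f(S/Z)`, and taking it to contain a lift of
a generator of the multiplicative group of the residue field gives `f(S/Z) ≤ e(S/Z)`.

Apply `e = f` to `B` over `K`, and to `L` and `C` over their common centre `L ∩ C`: the identity
`[L : K] [C : K] = [B : K]` then forces `e(L/K) f(C/K) = e(B/K) = f(L/K) e(C/K)`, and dividing by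
`f(C/K)` and `e(C/K)` gives the two equalities.
-/

namespace LocalDivisionAlgebra

section Index

open scoped Pointwise

theorem relIndex_ne_zero_of_isOpen_of_isCompact {G : Type*} [AddGroup G] [TopologicalSpace G]
    [IsTopologicalAddGroup G] {U V : AddSubgroup G} (hU : IsOpen (U : Set G))
    (hV : IsCompact (V : Set G)) : U.relIndex V ≠ 0 := by
  have : CompactSpace V := isCompact_iff_compactSpace.1 hV
  have : Finite (V ⧸ U.addSubgroupOf V) :=
    AddSubgroup.quotient_finite_of_isOpen _ (hU.preimage continuous_subtype_val)
  exact AddSubgroup.index_ne_zero_of_finite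

variable {H G : Type*} [Group H] [AddGroup G] [DistribMulAction H G] {c : H}

theorem relIndex_smul_self_eq_of_le {U V : AddSubgroup G} (hUV : U ≤ V)
    (hfin : U.relIndex V ≠ 0) (hU : c • U ≤ U) (hV : c • V ≤ V) :
    (c • U).relIndex U = (c • V).relIndex V := by
  have hsmul : c • U ≤ c • V := AddSubgroup.map_mono hUV
  have h := (AddSubgroup.relIndex_mul_relIndex _ _ _ hU hUV).trans
    (AddSubgroup.relIndex_mul_relIndex _ _ _ hsmul hV).symm
  rw [AddSubgroup.relIndex_pointwise_smul, mul_comm] at h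
  exact Nat.eq_of_mul_eq_mul_left (Nat.pos_of_ne_zero hfin) h

theorem relIndex_smul_self_eq_of_commensurable {U V : AddSubgroup G} (hUV : U.relIndex V ≠ 0)
    (hVU : V.relIndex U ≠ 0) (hU : c • U ≤ U) (hV : c • V ≤ V) :
    (c • U).relIndex U = (c • V).relIndex V := by
  have hinf : c • (U ⊓ V) ≤ U ⊓ V :=
    le_inf ((AddSubgroup.map_mono inf_le_left).trans hU)
      ((AddSubgroup.map_mono inf_le_right).trans hV)
  rw [← relIndex_smul_self_eq_of_le inf_le_left (by rwa [AddSubgroup.inf_relIndex_left]) hinf hU,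
    ← relIndex_smul_self_eq_of_le inf_le_right (by rwa [AddSubgroup.inf_relIndex_right]) hinf hV]

theorem relIndex_smul_self_pi {ι : Type*} [Fintype ι] (U : AddSubgroup G) :
    (c • AddSubgroup.pi Set.univ fun _ : ι => U).relIndex (AddSubgroup.pi Set.univ fun _ => U) =
      (c • U).relIndex U ^ Fintype.card ι := by
  let incl : (ι → U) →+ (ι → G) := U.subtype.compLeft ι
  have hrange : incl.range = AddSubgroup.pi Set.univ fun _ => U := by
    ext x
    exact ⟨by rintro ⟨y, rfl⟩ i -; exact (y i).2, fun hx => ⟨fun i => ⟨x i, hx i trivial⟩, rfl⟩⟩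
  have hcomap : (c • AddSubgroup.pi Set.univ fun _ : ι => U).comap incl =
      AddSubgroup.pi Set.univ fun _ => (c • U).addSubgroupOf U := by
    ext x
    simp only [AddSubgroup.mem_comap, AddSubgroup.mem_pi, AddSubgroup.mem_addSubgroupOf,
      AddSubgroup.mem_pointwise_smul_iff_inv_smul_mem]
    rfl
  rw [← hrange, ← AddSubgroup.index_comap, hrange, hcomap, AddSubgroup.index_pi, Finset.prod_const]
  rfl

/-- Any two compact open subgroups are commensurable, so it is enough to compute the index of
`c • U` in `U` for a product of copies of `O` in a coordinate space. -/
theorem relIndex_smul_self_eq_pow_finrank {K V : Type*} [NontriviallyNormedField K]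
    [CompleteSpace K] [AddCommGroup V] [Module K V] [FiniteDimensional K V] [TopologicalSpace V]
    [IsTopologicalAddGroup V] [ContinuousSMul K V] [T2Space V] {O : AddSubgroup K}
    (hOopen : IsOpen (O : Set K)) (hOcomp : IsCompact (O : Set K)) {U : AddSubgroup V}
    (hUopen : IsOpen (U : Set V)) (hUcomp : IsCompact (U : Set V)) {c : Kˣ} (hO : c • O ≤ O)
    (hU : c • U ≤ U) :
    (c • U).relIndex U = (c • O).relIndex O ^ Module.finrank K V := by
  let φ := (Module.finBasis K V).equivFun.toContinuousLinearEquiv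
  let P : AddSubgroup (Fin (Module.finrank K V) → K) := AddSubgroup.pi Set.univ fun _ => O
  have hP : c • P ≤ P := by
    rintro _ ⟨x, hx, rfl⟩ i -
    exact hO ⟨x i, hx i trivial, rfl⟩
  have hPopen : IsOpen (P : Set (Fin (Module.finrank K V) → K)) :=
    isOpen_set_pi Set.finite_univ fun _ _ => hOopen
  have hPcomp : IsCompact (P : Set (Fin (Module.finrank K V) → K)) :=
    isCompact_univ_pi fun _ => hOcomp
  let Q : AddSubgroup V := P.comap (φ : V →+ (Fin (Module.finrank K V) → K))
  have hsmul : c • Q = (c • P).comap (φ : V →+ (Fin (Module.finrank K V) → K)) := by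
    ext x
    exact AddSubgroup.mem_pointwise_smul_iff_inv_smul_mem.trans <|
      (iff_of_eq (congrArg (· ∈ P) (map_smul φ ((c⁻¹ : Kˣ) : K) x))).trans
        (AddSubgroup.mem_pointwise_smul_iff_inv_smul_mem (a := c) (x := φ x)).symm
  have hQ : c • Q ≤ Q := hsmul ▸ AddSubgroup.comap_mono hP
  have hQopen : IsOpen (Q : Set V) := hPopen.preimage φ.continuous
  have hQcomp : IsCompact (Q : Set V) := φ.toHomeomorph.isCompact_preimage.2 hPcomp
  calc (c • U).relIndex U = (c • Q).relIndex Q :=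
        relIndex_smul_self_eq_of_commensurable
          (relIndex_ne_zero_of_isOpen_of_isCompact hUopen hQcomp)
          (relIndex_ne_zero_of_isOpen_of_isCompact hQopen hUcomp) hU hQ
    _ = (c • P).relIndex P := by
        rw [hsmul, AddSubgroup.relIndex_comap, AddSubgroup.map_comap_eq_self_of_surjective]
        exact φ.surjective
    _ = (c • O).relIndex O ^ Module.finrank K V :=
        (relIndex_smul_self_pi O).trans (congrArg _ (Fintype.card_fin _))

end Index

section AbsoluteValue

theorem inv_mem_subalgebra {K B : Type*} [Field K] [DivisionRing B] [Algebra K B]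
    [FiniteDimensional K B] (S : Subalgebra K B) {x : B} (hx : x ∈ S) : x⁻¹ ∈ S := by
  by_cases hx0 : x = 0
  · simp [hx0]
  obtain ⟨y, hy⟩ := FiniteDimensional.exists_mul_eq_one K (x := (⟨x, hx⟩ : S))
    (by simpa [Subtype.ext_iff] using hx0)
  rw [inv_eq_of_mul_eq_one_right (congrArg Subtype.val hy)]
  exact y.2

variable {K : Type*} [NontriviallyNormedField K]
variable {B : Type*} [DivisionRing B] [Algebra K B]

theorem absVal_pow (x : B) (n : ℕ) : absVal K (x ^ n) = absVal K x ^ n := by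
  induction n with
  | zero => simp [absVal_one]
  | succ n ih => rw [pow_succ, absVal_mul, ih, pow_succ]

variable [FiniteDimensional K B]

theorem absVal_inv_eq (x : B) : absVal K x⁻¹ = (absVal K x)⁻¹ := by
  by_cases hx : x = 0
  · simp [hx, absVal_zero]
  · exact (inv_eq_of_mul_eq_one_right (absVal_inv hx)).symm

variable [IsUltrametricDist K] [LocallyCompactSpace K]

/-- The absolute value `ρ(π_S)` of a uniformizing parameter of `S`. -/
noncomputable def unifVal (S : Subalgebra K B) : ℝ := absVal K (uniformizer S : B)

theorem absVal_le_unifVal {S : Subalgebra K B} {x : B} (hxS : x ∈ S) (hx : absVal K x < 1) :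
    absVal K x ≤ unifVal S := by
  have h : (⟨x, hxS, hx.le⟩ : integers S) ∈ Ideal.span {uniformizer S} :=
    (exists_isUniformizer S).choose_spec ▸ hx
  obtain ⟨a, ha⟩ := Ideal.mem_span_singleton'.1 h
  rw [← show (a : B) * uniformizer S = x from congrArg Subtype.val ha, absVal_mul]
  exact mul_le_of_le_one_left (absVal_nonneg _) a.2.2

theorem unifVal_lt_one (S : Subalgebra K B) : unifVal S < 1 := by
  have h : uniformizer S ∈ maxIdeal S :=
    (exists_isUniformizer S).choose_spec ▸ Ideal.mem_span_singleton_self _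
  exact h

theorem unifVal_pos (S : Subalgebra K B) : 0 < unifVal S := by
  obtain ⟨b, hb0, hb1⟩ := NormedField.exists_norm_lt_one K
  rw [← absVal_algebraMap (B := B)] at hb0 hb1
  exact hb0.trans_le (absVal_le_unifVal (S.algebraMap_mem b) hb1)

theorem uniformizer_ne_zero (S : Subalgebra K B) : (uniformizer S : B) ≠ 0 := fun h =>
  (unifVal_pos S).ne' (by rw [unifVal, h, absVal_zero])

theorem exists_absVal_eq_unifVal_pow {S : Subalgebra K B} {x : B} (hxS : x ∈ S) (hx0 : x ≠ 0)
    (hx : absVal K x ≤ 1) : ∃ n : ℕ, absVal K x = unifVal S ^ n := by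
  obtain ⟨n, hlt, hle⟩ :=
    exists_nat_pow_near_of_lt_one (absVal_pos (K := K) hx0) hx (unifVal_pos S) (unifVal_lt_one S)
  refine ⟨n, hle.antisymm ?_⟩
  have hpos : 0 < unifVal S ^ n := pow_pos (unifVal_pos S) n
  have hval : absVal K (x * ((uniformizer S : B) ^ n)⁻¹) = absVal K x / unifVal S ^ n := by
    rw [absVal_mul, absVal_inv_eq, absVal_pow, unifVal, div_eq_mul_inv]
  by_contra! hcon
  have hmem := S.mul_mem hxS (inv_mem_subalgebra S (S.pow_mem (uniformizer S).2.1 n))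
  have h := absVal_le_unifVal hmem (by rwa [hval, div_lt_one hpos])
  rw [hval, div_le_iff₀ hpos, ← pow_succ'] at h
  exact absurd hlt h.not_gt

theorem ramificationIndex_eq_of_unifVal_eq_pow {T S : Subalgebra K B} (h : T ≤ S) {e : ℕ}
    (he : unifVal T = unifVal S ^ e) : ramificationIndex h = e := by
  change Real.logb (unifVal S) (unifVal T) = e
  rw [he, Real.logb_pow, Real.logb_self_eq_one_iff.2, mul_one]
  exact ⟨(unifVal_pos S).ne', (unifVal_lt_one S).ne, by linarith [unifVal_pos S]⟩

theorem exists_unifVal_eq_pow {T S : Subalgebra K B} (h : T ≤ S) :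
    ∃ e : ℕ, unifVal T = unifVal S ^ e :=
  exists_absVal_eq_unifVal_pow (h (uniformizer T).2.1) (uniformizer_ne_zero T) (uniformizer T).2.2

theorem one_le_ramificationIndex {T S : Subalgebra K B} (h : T ≤ S) :
    1 ≤ ramificationIndex h := by
  obtain ⟨e, he⟩ := exists_unifVal_eq_pow h
  rw [ramificationIndex_eq_of_unifVal_eq_pow h he, Nat.one_le_cast, Nat.one_le_iff_ne_zero]
  rintro rfl
  exact (unifVal_lt_one T).ne (by rw [he, pow_zero])

theorem ramificationIndex_mul {T S R : Subalgebra K B} (hTS : T ≤ S) (hSR : S ≤ R) :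
    ramificationIndex hTS * ramificationIndex hSR = ramificationIndex (hTS.trans hSR) := by
  rw [mul_comm]
  have h0 := unifVal_pos S
  exact Real.mul_logb h0.ne' (unifVal_lt_one S).ne (by change unifVal S ≠ -1; linarith)

theorem ramificationIndex_eq_one {T S : Subalgebra K B} (h : T ≤ S)
    (hT : (uniformizer S : B) ∈ T) : ramificationIndex h = 1 := by
  have hle : unifVal S ≤ unifVal T := absVal_le_unifVal hT (unifVal_lt_one S)
  have hge : unifVal T ≤ unifVal S := absVal_le_unifVal (h (uniformizer T).2.1) (unifVal_lt_one T)
  simpa using ramificationIndex_eq_of_unifVal_eq_pow h (e := 1) (by rw [pow_one, hge.antisymm hle])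

end AbsoluteValue

section UltrametricBall

open scoped Pointwise

/-- The closed ball of radius `r > 0` about the origin, as an additive subgroup. -/
abbrev closedBallAddSubgroup (V : Type*) [SeminormedAddCommGroup V] [IsUltrametricDist V] {r : ℝ}
    (hr : 0 < r) : AddSubgroup V :=
  (IsUltrametricDist.closedBall_openAddSubgroup V hr).toAddSubgroup

theorem mem_closedBallAddSubgroup {V : Type*} [SeminormedAddCommGroup V] [IsUltrametricDist V]
    {r : ℝ} {hr : 0 < r} {x : V} : x ∈ closedBallAddSubgroup V hr ↔ ‖x‖ ≤ r :=
  mem_closedBall_zero_iff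

theorem closedBallAddSubgroup_mono {V : Type*} [SeminormedAddCommGroup V] [IsUltrametricDist V]
    {r s : ℝ} (hr : 0 < r) (hs : 0 < s) (hrs : r ≤ s) :
    closedBallAddSubgroup V hr ≤ closedBallAddSubgroup V hs :=
  Metric.closedBall_subset_closedBall hrs

variable {K V : Type*} [NormedField K] [SeminormedAddCommGroup V] [NormedSpace K V]
  [IsUltrametricDist V]

theorem units_smul_closedBallAddSubgroup_one (c : Kˣ) :
    c • closedBallAddSubgroup V one_pos = closedBallAddSubgroup V (norm_pos_iff.2 c.ne_zero) := by
  refine SetLike.coe_injective ((smul_closedBall' c.ne_zero (0 : V) 1).trans ?_)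
  rw [smul_zero, mul_one]
  rfl

theorem units_smul_closedBallAddSubgroup_one_le {c : Kˣ} (hc : ‖(c : K)‖ ≤ 1) :
    c • closedBallAddSubgroup V one_pos ≤ closedBallAddSubgroup V one_pos := by
  rw [units_smul_closedBallAddSubgroup_one]
  exact closedBallAddSubgroup_mono _ one_pos hc

theorem relIndex_closedBallAddSubgroup_norm_eq_pow_finrank {K V : Type*}
    [NontriviallyNormedField K] [IsUltrametricDist K] [ProperSpace K] [NormedAddCommGroup V]
    [NormedSpace K V] [IsUltrametricDist V] [FiniteDimensional K V] {c : Kˣ} (hc : ‖(c : K)‖ ≤ 1) :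
    (closedBallAddSubgroup V (norm_pos_iff.2 c.ne_zero)).relIndex
        (closedBallAddSubgroup V one_pos) =
      (c • closedBallAddSubgroup K one_pos).relIndex (closedBallAddSubgroup K one_pos) ^
        Module.finrank K V := by
  have : ProperSpace V := FiniteDimensional.proper K V
  rw [← units_smul_closedBallAddSubgroup_one]
  exact relIndex_smul_self_eq_pow_finrank (OpenAddSubgroup.isOpen _) (isCompact_closedBall _ _)
    (OpenAddSubgroup.isOpen _) (isCompact_closedBall _ _)
    (units_smul_closedBallAddSubgroup_one_le hc) (units_smul_closedBallAddSubgroup_one_le hc)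

end UltrametricBall

section ResidueField

open scoped Pointwise

variable {K : Type*} [NontriviallyNormedField K] [IsUltrametricDist K] [LocallyCompactSpace K]
variable {B : Type*} [DivisionRing B] [Algebra K B] [FiniteDimensional K B]

theorem residue_eq_zero_iff {S : Subalgebra K B} {x : integers S} :
    Ideal.Quotient.mk (maxIdeal S) x = 0 ↔ absVal K (x : B) < 1 :=
  Ideal.Quotient.eq_zero_iff_mem

instance residueField_isDomain (S : Subalgebra K B) : IsDomain (ResidueField S) := by
  have : Nontrivial (ResidueField S) := nontrivial_of_ne 1 0 fun h =>
    (residue_eq_zero_iff.1 h).ne absVal_one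
  have : NoZeroDivisors (ResidueField S) := ⟨fun {a b} hab => by
    obtain ⟨x, rfl⟩ := Ideal.Quotient.mk_surjective a
    obtain ⟨y, rfl⟩ := Ideal.Quotient.mk_surjective b
    rw [← map_mul, residue_eq_zero_iff, Subring.coe_mul, absVal_mul] at hab
    rw [residue_eq_zero_iff, residue_eq_zero_iff]
    by_contra! hcon
    rw [x.2.2.antisymm hcon.1, y.2.2.antisymm hcon.2, one_mul] at hab
    exact lt_irrefl _ hab⟩
  exact NoZeroDivisors.to_isDomain _

/-- A subalgebra of `B` carries the norm `ρ`. -/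
noncomputable instance (S : Subalgebra K B) : NormedAddCommGroup S :=
  AddGroupNorm.toNormedAddCommGroup
    { toFun := fun x => absVal K (x : B)
      map_zero' := absVal_zero
      add_le' := fun x y => (absVal_add_le _ _).trans
        (max_le_add_of_nonneg (absVal_nonneg _) (absVal_nonneg _))
      neg' := fun x => absVal_neg _
      eq_zero_of_map_eq_zero' := fun x hx => by
        by_contra h
        exact (absVal_pos fun hx0 => h (Subtype.ext hx0)).ne' hx }

theorem norm_eq_absVal {S : Subalgebra K B} (x : S) : ‖x‖ = absVal K (x : B) := rfl

noncomputable instance (S : Subalgebra K B) : NormedSpace K S where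
  norm_smul_le c x := by
    rw [norm_eq_absVal, Subalgebra.coe_smul, Algebra.smul_def, absVal_mul, absVal_algebraMap,
      norm_eq_absVal]

instance (S : Subalgebra K B) : IsUltrametricDist S :=
  IsUltrametricDist.isUltrametricDist_of_isNonarchimedean_norm fun x y => absVal_add_le (x : B) y

theorem map_mulLeft_closedBallAddSubgroup {S : Subalgebra K B} {y : S} (hy : y ≠ 0) {r : ℝ}
    (hr : 0 < r) :
    (closedBallAddSubgroup S hr).map (AddMonoidHom.mulLeft y) =
      closedBallAddSubgroup S (mul_pos (norm_pos_iff.2 hy) hr) := by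
  have hy0 : (y : B) ≠ 0 := fun h => hy (Subtype.ext h)
  ext x
  rw [AddSubgroup.mem_map, mem_closedBallAddSubgroup]
  constructor
  · rintro ⟨z, hz, rfl⟩
    exact (absVal_mul (K := K) (y : B) z).trans_le
      (mul_le_mul_of_nonneg_left (mem_closedBallAddSubgroup.1 hz) (norm_nonneg y))
  · intro hx
    refine ⟨⟨(y : B)⁻¹ * x, S.mul_mem (inv_mem_subalgebra S y.2) x.2⟩, ?_,
      Subtype.ext (mul_inv_cancel_left₀ hy0 _)⟩
    rw [mem_closedBallAddSubgroup, norm_eq_absVal, absVal_mul, absVal_inv_eq]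
    exact (inv_mul_le_iff₀ (absVal_pos hy0)).2 hx

theorem relIndex_closedBallAddSubgroup_unifVal (S : Subalgebra K B) :
    (closedBallAddSubgroup S (unifVal_pos S)).relIndex (closedBallAddSubgroup S one_pos) =
      Nat.card (ResidueField S) := by
  let incl : integers S →+ S :=
    { toFun := fun x => ⟨x, x.2.1⟩
      map_zero' := rfl
      map_add' := fun _ _ => rfl }
  have hrange : incl.range = closedBallAddSubgroup S one_pos := by
    ext x
    rw [mem_closedBallAddSubgroup]
    exact ⟨by rintro ⟨y, rfl⟩; exact y.2.2, fun hx => ⟨⟨x, x.2, hx⟩, rfl⟩⟩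
  have hcomap : (closedBallAddSubgroup S (unifVal_pos S)).comap incl =
      (maxIdeal S).toAddSubgroup := by
    ext x
    rw [AddSubgroup.mem_comap, mem_closedBallAddSubgroup]
    exact ⟨fun hx => hx.trans_lt (unifVal_lt_one S), fun hx => absVal_le_unifVal x.2.1 hx⟩
  rw [← hrange, ← AddSubgroup.index_comap, hcomap]
  rfl

theorem relIndex_closedBallAddSubgroup_unifVal_pow (S : Subalgebra K B) (n : ℕ) :
    (closedBallAddSubgroup S (pow_pos (unifVal_pos S) n)).relIndex
        (closedBallAddSubgroup S one_pos) = Nat.card (ResidueField S) ^ n := by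
  induction n with
  | zero => simp only [pow_zero, AddSubgroup.relIndex_self]
  | succ n ih =>
    let y : S := ⟨(uniformizer S : B) ^ n, S.pow_mem (uniformizer S).2.1 n⟩
    have hy0 : y ≠ 0 := fun h => pow_ne_zero n (uniformizer_ne_zero S) (congrArg Subtype.val h)
    have hy : ‖y‖ = unifVal S ^ n := absVal_pow (uniformizer S : B) n
    have hstep : (closedBallAddSubgroup S (pow_pos (unifVal_pos S) (n + 1))).relIndex
        (closedBallAddSubgroup S (pow_pos (unifVal_pos S) n)) = Nat.card (ResidueField S) := by
      have hmap := AddSubgroup.relIndex_map_map_of_injective (f := AddMonoidHom.mulLeft y)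
        (closedBallAddSubgroup S (unifVal_pos S)) (closedBallAddSubgroup S one_pos)
        (mul_right_injective₀ hy0)
      rw [map_mulLeft_closedBallAddSubgroup hy0, map_mulLeft_closedBallAddSubgroup hy0,
        relIndex_closedBallAddSubgroup_unifVal] at hmap
      simpa only [hy, mul_one, ← pow_succ] using hmap
    rw [← AddSubgroup.relIndex_mul_relIndex _ _ _
      (closedBallAddSubgroup_mono (pow_pos (unifVal_pos S) (n + 1)) (pow_pos (unifVal_pos S) n)
        (pow_le_pow_of_le_one (unifVal_pos S).le (unifVal_lt_one S).le n.le_succ))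
      (closedBallAddSubgroup_mono _ one_pos (pow_le_one₀ (unifVal_pos S).le (unifVal_lt_one S).le)),
      hstep, ih, pow_succ']

instance residueField_finite (S : Subalgebra K B) : Finite (ResidueField S) := by
  have : ProperSpace K := ProperSpace.of_locallyCompactSpace K
  have : ProperSpace S := FiniteDimensional.proper K S
  refine Nat.finite_of_card_ne_zero ?_
  rw [← relIndex_closedBallAddSubgroup_unifVal]
  exact relIndex_ne_zero_of_isOpen_of_isCompact (OpenAddSubgroup.isOpen _)
    (isCompact_closedBall _ _)

theorem one_lt_natCard_residueField (S : Subalgebra K B) : 1 < Nat.card (ResidueField S) :=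
  Finite.one_lt_card

theorem natCard_residueField {T S : Subalgebra K B} (h : T ≤ S) :
    Nat.card (ResidueField S) = Nat.card (ResidueField T) ^ residualDegree h := by
  classical
  let _ : Fintype (ResidueField T) := Fintype.ofFinite _
  let _ : DivisionRing (ResidueField T) := Fintype.divisionRingOfIsDomain _
  let _ : Module (ResidueField T) (ResidueField S) := Module.compHom _ (residueMap h)
  exact Module.natCard_eq_pow_finrank

theorem residualDegree_pos {T S : Subalgebra K B} (h : T ≤ S) : 0 < residualDegree h := by
  rw [Nat.pos_iff_ne_zero]
  intro h0
  have hcard := natCard_residueField h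
  rw [h0, pow_zero] at hcard
  exact (one_lt_natCard_residueField S).ne' hcard

theorem residualDegree_mul {T S R : Subalgebra K B} (hTS : T ≤ S) (hSR : S ≤ R) :
    residualDegree hTS * residualDegree hSR = residualDegree (hTS.trans hSR) := by
  refine Nat.pow_right_injective (one_lt_natCard_residueField T) ?_
  change _ ^ _ = _ ^ _
  rw [pow_mul, ← natCard_residueField hTS, ← natCard_residueField hSR, ← natCard_residueField]

theorem residualDegree_eq_one {T S : Subalgebra K B} (h : T ≤ S)
    (hsurj : Function.Surjective (residueMap h)) : residualDegree h = 1 := by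
  have hcard := natCard_residueField h ▸ Nat.card_le_card_of_surjective _ hsurj
  have hle : residualDegree h ≤ 1 := by
    rwa [← Nat.pow_le_pow_iff_right (one_lt_natCard_residueField T), pow_one]
  exact hle.antisymm (residualDegree_pos h)

/-- Both sides are the index of `π 𝒪_S` in `𝒪_S`, for a uniformizing parameter `π` of `K`. -/
theorem natCard_residueField_pow_eq_pow_finrank (S : Subalgebra K B) {e : ℕ}
    (he : unifVal (⊥ : Subalgebra K B) = unifVal S ^ e) :
    Nat.card (ResidueField S) ^ e =
      Nat.card (ResidueField (⊥ : Subalgebra K B)) ^ Module.finrank K S := by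
  have : ProperSpace K := ProperSpace.of_locallyCompactSpace K
  obtain ⟨a, ha⟩ := Algebra.mem_bot.1 (uniformizer (⊥ : Subalgebra K B)).2.1
  have hnorm : ‖a‖ = unifVal (⊥ : Subalgebra K B) := by
    rw [← absVal_algebraMap (B := B), ha, unifVal]
  let c : Kˣ := Units.mk0 a (norm_pos_iff.1 (hnorm ▸ unifVal_pos _))
  have hc : ‖(c : K)‖ ≤ 1 := hnorm.trans_le (unifVal_lt_one _).le
  have hindex : ∀ (R : Subalgebra K B) (n : ℕ), unifVal (⊥ : Subalgebra K B) = unifVal R ^ n →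
      Nat.card (ResidueField R) ^ n = (c • closedBallAddSubgroup K one_pos).relIndex
        (closedBallAddSubgroup K one_pos) ^ Module.finrank K R := by
    intro R n hn
    rw [← relIndex_closedBallAddSubgroup_unifVal_pow,
      ← relIndex_closedBallAddSubgroup_norm_eq_pow_finrank (c := c) hc]
    simp only [c, Units.val_mk0, hnorm, hn]
  have hbot := hindex ⊥ 1 (pow_one _).symm
  rw [Subalgebra.finrank_bot, pow_one, pow_one] at hbot
  rw [hindex S e he, hbot]

theorem ramificationIndex_bot_mul_residualDegree (S : Subalgebra K B) :
    ramificationIndex (bot_le : ⊥ ≤ S) * residualDegree (bot_le : ⊥ ≤ S) = Module.finrank K S := by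
  obtain ⟨e, he⟩ := exists_unifVal_eq_pow (bot_le : ⊥ ≤ S)
  have hpow := natCard_residueField_pow_eq_pow_finrank S he
  rw [natCard_residueField (bot_le : ⊥ ≤ S), ← pow_mul] at hpow
  rw [ramificationIndex_eq_of_unifVal_eq_pow _ he, ← Nat.cast_mul, mul_comm]
  exact congrArg Nat.cast (Nat.pow_right_injective (one_lt_natCard_residueField _) hpow)

theorem finrank_mul_ramificationIndex_mul_residualDegree {T S : Subalgebra K B} (h : T ≤ S) :
    Module.finrank K T * (ramificationIndex h * residualDegree h) = Module.finrank K S := by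
  rw [← ramificationIndex_bot_mul_residualDegree, ← ramificationIndex_bot_mul_residualDegree,
    ← ramificationIndex_mul bot_le h, ← residualDegree_mul bot_le h, Nat.cast_mul]
  ring

end ResidueField

section Centralizer

variable {K A : Type*} [Field K] [DivisionRing A] [Algebra K A]

/-- A shortest nontrivial relation, scaled to have a coefficient `1`, has all its coefficients in
the centralizer: the relations obtained from it by multiplying by `l` on either side of the
coefficients differ by a shorter one. -/
theorem eq_zero_of_forall_sum_mul_mul_eq_zero (L : Subalgebra K A) {ι : Type*} [Fintype ι]
    {b : ι → A} (hb : LinearIndependent (Subalgebra.centralizer K (L : Set A)) b) {x : ι → A}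
    (hx : ∀ l ∈ L, ∑ j, x j * l * b j = 0) : x = 0 := by
  classical
  induction hn : (Finset.univ.filter fun j => x j ≠ 0).card using Nat.strong_induction_on
    generalizing x with
  | _ n ih =>
  by_contra hx0
  obtain ⟨j₀, hj₀⟩ := Function.ne_iff.1 hx0
  rw [Pi.zero_apply] at hj₀
  let y : ι → A := fun j => (x j₀)⁻¹ * x j
  have hy1 : y j₀ = 1 := inv_mul_cancel₀ hj₀
  have hy : ∀ l ∈ L, ∑ j, y j * l * b j = 0 := fun l hl => by
    simpa [Finset.mul_sum, y, mul_assoc] using congrArg ((x j₀)⁻¹ * ·) (hx l hl)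
  have hcomm : ∀ l ∈ L, (fun j => y j * l - l * y j) = 0 := by
    intro l hl
    refine ih _ ?_ (fun l' hl' => ?_) rfl
    · rw [← hn]
      refine Finset.card_lt_card (Finset.ssubset_iff_of_subset (fun j hj => ?_) |>.2
        ⟨j₀, by simpa using hj₀, by simp [hy1]⟩)
      simp only [Finset.mem_filter, Finset.mem_univ, true_and] at hj ⊢
      exact fun hxj => hj (by simp [y, hxj])
    · have h1 := hy _ (L.mul_mem hl hl')
      have h2 := congrArg (l * ·) (hy _ hl')
      simp only [Finset.mul_sum, mul_zero] at h2
      rw [← sub_eq_zero.2 (h1.trans h2.symm), ← Finset.sum_sub_distrib]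
      exact Finset.sum_congr rfl fun j _ => by simp only [sub_mul, mul_assoc]
  have hmem : ∀ j, y j ∈ Subalgebra.centralizer K (L : Set A) := fun j =>
    (Subalgebra.mem_centralizer_iff K).2 fun l hl => (sub_eq_zero.1 (congrFun (hcomm l hl) j)).symm
  have h0 := Fintype.linearIndependent_iff.1 hb (fun j => ⟨y j, hmem j⟩)
    (by simpa [Subalgebra.smul_def] using hy 1 L.one_mem) j₀
  exact one_ne_zero (hy1.symm.trans (congrArg Subtype.val h0))

theorem card_le_card_of_linearIndependent_centralizer {L : Subalgebra K A} {ι κ : Type*}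
    [Fintype ι] [Fintype κ] {b : ι → A}
    (hb : LinearIndependent (Subalgebra.centralizer K (L : Set A)) b) (c : κ → A)
    (hc : ∀ l ∈ L, ∃ d : κ → A, (∀ i j, Commute (d i) (b j)) ∧ l = ∑ i, c i * d i) :
    Fintype.card ι ≤ Fintype.card κ := by
  let Φ : (ι → A) →ₗ[A] (κ → A) :=
    { toFun := fun x i => ∑ j, x j * c i * b j
      map_add' := fun x y => by
        ext i
        simp [add_mul, Finset.sum_add_distrib]
      map_smul' := fun a x => by
        ext i
        simp [Finset.mul_sum, mul_assoc] }
  have hΦ : Function.Injective Φ := by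
    rw [injective_iff_map_eq_zero]
    intro x hx
    refine eq_zero_of_forall_sum_mul_mul_eq_zero L hb fun l hl => ?_
    obtain ⟨d, hd, rfl⟩ := hc l hl
    calc ∑ j, x j * (∑ i, c i * d i) * b j = ∑ j, ∑ i, x j * c i * b j * d i := by
          refine Finset.sum_congr rfl fun j _ => ?_
          rw [Finset.mul_sum, Finset.sum_mul]
          refine Finset.sum_congr rfl fun i _ => ?_
          rw [mul_assoc, mul_assoc, (hd i j).eq, ← mul_assoc, ← mul_assoc]
      _ = ∑ i, Φ x i * d i := by
          rw [Finset.sum_comm]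
          exact Finset.sum_congr rfl fun i _ => (Finset.sum_mul _ _ _).symm
      _ = 0 := by simp [hx]
  simpa using LinearMap.finrank_le_finrank_of_injective hΦ

variable [FiniteDimensional K A]

theorem finrank_le_finrank_mul_finrank_centralizer (L : Subalgebra K A) :
    Module.finrank K A ≤
      Module.finrank K L * Module.finrank K (Subalgebra.centralizer K (L : Set A)) := by
  let C := Subalgebra.centralizer K (L : Set A)
  let _ : DivisionRing C := divisionRingOfFiniteDimensional K C
  have : Module.Finite C A := Module.Finite.of_restrictScalars_finite K C A
  let l := Module.finBasis K L
  have hcard := card_le_card_of_linearIndependent_centralizer (L := L)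
    (Module.finBasis C A).linearIndependent (fun i => (l i : A)) fun a ha =>
      ⟨fun i => algebraMap K A (l.repr ⟨a, ha⟩ i), fun i j => Algebra.commutes _ _, by
        simpa [Algebra.smul_def, Algebra.commutes] using
          congrArg Subtype.val (l.sum_repr ⟨a, ha⟩).symm⟩
  rw [Fintype.card_fin, Fintype.card_fin] at hcard
  rw [← Module.finrank_mul_finrank K C A, mul_comm]
  exact Nat.mul_le_mul_right _ hcard

theorem exists_right_spanning (C : Subalgebra K A) :
    ∃ (n : ℕ) (c : Fin n → A), n * Module.finrank K C = Module.finrank K A ∧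
      ∀ a, ∃ d : Fin n → C, a = ∑ i, c i * d i := by
  let _ : DivisionRing C.op := divisionRingOfFiniteDimensional K C.op
  have : Module.Finite C.op Aᵐᵒᵖ := Module.Finite.of_restrictScalars_finite K C.op Aᵐᵒᵖ
  let b := Module.finBasis C.op Aᵐᵒᵖ
  refine ⟨_, fun i => (b i).unop, ?_, fun a => ⟨fun i => ⟨_, (b.repr (.op a) i).2⟩, ?_⟩⟩
  · rw [C.linearEquivOp.finrank_eq, mul_comm, Module.finrank_mul_finrank K C.op Aᵐᵒᵖ]
    exact (MulOpposite.opLinearEquiv K).finrank_eq.symm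
  · refine MulOpposite.op_injective ((b.sum_repr (.op a)).symm.trans ?_)
    rw [Finset.op_sum]
    exact Finset.sum_congr rfl fun i _ => rfl

theorem finrank_mul_finrank_centralizer_le {L : Subalgebra K A}
    (hL : Subalgebra.center K A ≤ L) :
    Module.finrank K L * Module.finrank K (Subalgebra.centralizer K (L : Set A)) ≤
      Module.finrank K A * Module.finrank K (Subalgebra.center K A) := by
  obtain ⟨n, c, hn, hc⟩ := exists_right_spanning (Subalgebra.centralizer K (L : Set A))
  rw [← Subalgebra.centralizer_univ, ← Algebra.coe_top (R := K)] at hL ⊢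
  let Z := Subalgebra.centralizer K ((⊤ : Subalgebra K A) : Set A)
  let _ : DivisionRing Z := divisionRingOfFiniteDimensional K Z
  let M : Submodule Z A :=
    { L.toSubmodule with smul_mem' := fun z _ hx => L.mul_mem (hL z.2) hx }
  have : Module.Finite K M := inferInstanceAs (Module.Finite K L)
  have : Module.Finite Z M := Module.Finite.of_restrictScalars_finite K Z M
  let b := Module.finBasis Z M
  have hcard := card_le_card_of_linearIndependent_centralizer (L := (⊤ : Subalgebra K A))
    (b.linearIndependent.map' M.subtype M.ker_subtype) c fun a _ => by
      obtain ⟨d, hd⟩ := hc a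
      exact ⟨fun i => d i, fun i j =>
        ((Subalgebra.mem_centralizer_iff K).1 (d i).2 (b j) (b j).2).symm, hd⟩
  rw [Fintype.card_fin, Fintype.card_fin] at hcard
  calc Module.finrank K L * Module.finrank K (Subalgebra.centralizer K (L : Set A))
      = Module.finrank K Z * Module.finrank Z M *
          Module.finrank K (Subalgebra.centralizer K (L : Set A)) := by
        rw [Module.finrank_mul_finrank K Z M]
        rfl
    _ ≤ Module.finrank K Z * n * Module.finrank K (Subalgebra.centralizer K (L : Set A)) := by
        gcongr
    _ = Module.finrank K A * Module.finrank K Z := by rw [← hn]; ring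

theorem finrank_mul_finrank_centralizer [Algebra.IsCentral K A] (L : Subalgebra K A) :
    Module.finrank K L * Module.finrank K (Subalgebra.centralizer K (L : Set A)) =
      Module.finrank K A := by
  have hcenter := Algebra.IsCentral.center_eq_bot K A
  have hle := finrank_mul_finrank_centralizer_le (hcenter.trans_le (bot_le : ⊥ ≤ L))
  rw [hcenter, Subalgebra.finrank_bot, mul_one] at hle
  exact hle.antisymm (finrank_le_finrank_mul_finrank_centralizer L)

theorem centralizer_centralizer_eq [Algebra.IsCentral K A] (L : Subalgebra K A) :
    Subalgebra.centralizer K (Subalgebra.centralizer K (L : Set A) : Set A) = L := by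
  have h := (finrank_mul_finrank_centralizer L).trans
    (finrank_mul_finrank_centralizer (Subalgebra.centralizer K (L : Set A))).symm
  rw [mul_comm] at h
  exact (Subalgebra.eq_of_le_of_finrank_eq (Subalgebra.le_centralizer_centralizer K)
    (Nat.eq_of_mul_eq_mul_left Module.finrank_pos h)).symm

end Centralizer

section SubalgebraCenter

variable {K B : Type*} [CommSemiring K] [Semiring B] [Algebra K B]

/-- The centre of a subalgebra `S` of `B`, as a subalgebra of `B`. -/
def subalgebraCenter (S : Subalgebra K B) : Subalgebra K B :=
  S ⊓ Subalgebra.centralizer K (S : Set B)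

theorem subalgebraCenter_le (S : Subalgebra K B) : subalgebraCenter S ≤ S := inf_le_left

theorem commute_of_mem_subalgebraCenter {S : Subalgebra K B} {x y : B}
    (hx : x ∈ subalgebraCenter S) (hy : y ∈ S) : Commute x y :=
  ((Subalgebra.mem_centralizer_iff K).1 hx.2 y hy).symm

theorem subalgebraCenter_top [Algebra.IsCentral K B] :
    subalgebraCenter (⊤ : Subalgebra K B) = ⊥ := by
  rw [subalgebraCenter, top_inf_eq, Algebra.coe_top, Subalgebra.centralizer_univ,
    Algebra.IsCentral.center_eq_bot]

theorem center_eq_comap_subalgebraCenter (S : Subalgebra K B) :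
    Subalgebra.center K S = (subalgebraCenter S).comap S.val := by
  ext x
  rw [Subalgebra.mem_center_iff]
  exact ⟨fun h => ⟨x.2, (Subalgebra.mem_centralizer_iff K).2 fun y hy =>
      congrArg Subtype.val (h ⟨y, hy⟩)⟩,
    fun h y => Subtype.ext (commute_of_mem_subalgebraCenter h y.2).symm⟩

theorem finrank_comap_val {F S : Subalgebra K B} (h : F ≤ S) :
    Module.finrank K (F.comap S.val) = Module.finrank K F := by
  have hmap : (F.comap S.val).map S.val = F :=
    Subalgebra.map_comap_eq_self (by rwa [Subalgebra.range_val])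
  rw [((F.comap S.val).equivMapOfInjective S.val Subtype.val_injective).toLinearEquiv.finrank_eq,
    hmap]

theorem exists_commutative_subalgebra_mem {S : Subalgebra K B} {x : B} (hx : x ∈ S) :
    ∃ F : Subalgebra K B, subalgebraCenter S ≤ F ∧ F ≤ S ∧
      (∀ y ∈ F, ∀ z ∈ F, Commute y z) ∧ x ∈ F := by
  let T := S ⊓ Subalgebra.centralizer K {x}
  have hTS : T ≤ S := inf_le_left
  have hxT : ∀ y ∈ T, y * x = x * y := fun y hy =>
    ((Subalgebra.mem_centralizer_iff K).1 hy.2 x rfl).symm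
  refine ⟨subalgebraCenter T, fun z hz => ⟨⟨hz.1, ?_⟩, ?_⟩, (subalgebraCenter_le T).trans hTS,
    fun y hy z hz => commute_of_mem_subalgebraCenter hy hz.1,
    ⟨hx, (Subalgebra.mem_centralizer_iff K).2 fun y hy => hy ▸ rfl⟩,
    (Subalgebra.mem_centralizer_iff K).2 hxT⟩
  · exact (Subalgebra.mem_centralizer_iff K).2 fun y hy =>
      (commute_of_mem_subalgebraCenter hz (hy ▸ hx)).symm
  · exact (Subalgebra.mem_centralizer_iff K).2 fun y hy =>
      (commute_of_mem_subalgebraCenter hz (hTS hy)).symm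

theorem subalgebraCenter_centralizer {K B : Type*} [Field K] [DivisionRing B]
    [Algebra K B] [FiniteDimensional K B] [Algebra.IsCentral K B] (L : Subalgebra K B) :
    subalgebraCenter (Subalgebra.centralizer K (L : Set B)) = subalgebraCenter L := by
  rw [subalgebraCenter, centralizer_centralizer_eq, inf_comm, subalgebraCenter]

theorem finrank_mul_self_le_of_commutative {K B : Type*} [Field K] [DivisionRing B]
    [Algebra K B] [FiniteDimensional K B] {F S : Subalgebra K B}
    (hZF : subalgebraCenter S ≤ F) (hFS : F ≤ S) (hcomm : ∀ x ∈ F, ∀ y ∈ F, Commute x y) :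
    Module.finrank K F * Module.finrank K F ≤
      Module.finrank K S * Module.finrank K (subalgebraCenter S) := by
  let _ : DivisionRing S := divisionRingOfFiniteDimensional K S
  have hcenter := center_eq_comap_subalgebraCenter S
  have hle : F.comap S.val ≤ Subalgebra.centralizer K (F.comap S.val : Set S) := fun x hx =>
    (Subalgebra.mem_centralizer_iff K).2 fun y hy => Subtype.ext (hcomm y hy x hx)
  calc Module.finrank K F * Module.finrank K F
      = Module.finrank K (F.comap S.val) * Module.finrank K (F.comap S.val) := by
        rw [finrank_comap_val hFS]
    _ ≤ Module.finrank K (F.comap S.val) *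
          Module.finrank K (Subalgebra.centralizer K (F.comap S.val : Set S)) :=
        Nat.mul_le_mul_left _ (LinearMap.finrank_le_finrank_of_injective
          (f := (Subalgebra.inclusion hle).toLinearMap) (Subalgebra.inclusion_injective hle))
    _ ≤ Module.finrank K S * Module.finrank K (Subalgebra.center K S) :=
        finrank_mul_finrank_centralizer_le (hcenter.trans_le fun _ hx => hZF hx)
    _ = Module.finrank K S * Module.finrank K (subalgebraCenter S) := by
        rw [hcenter, finrank_comap_val (subalgebraCenter_le S)]

end SubalgebraCenter

section RamificationOverCenter

theorem exists_forall_eq_pow_of_finite_domain (R : Type*) [Ring R] [IsDomain R] [Finite R] :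
    ∃ a : R, ∀ x : R, x ≠ 0 → ∃ n : ℕ, a ^ n = x := by
  let _ : Field R := (Finite.isDomain_to_isField R).toField
  obtain ⟨a, ha⟩ := IsCyclic.exists_monoid_generator (α := Rˣ)
  refine ⟨a, fun x hx => ?_⟩
  obtain ⟨n, hn⟩ := ha (Units.mk0 x hx)
  exact ⟨n, by simpa using congrArg Units.val hn⟩

variable {K : Type*} [NontriviallyNormedField K] [IsUltrametricDist K] [LocallyCompactSpace K]
variable {B : Type*} [DivisionRing B] [Algebra K B] [FiniteDimensional K B]

theorem exists_forall_residueMap_surjective_of_mem (S : Subalgebra K B) :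
    ∃ x ∈ S, ∀ (F : Subalgebra K B) (h : F ≤ S), x ∈ F → Function.Surjective (residueMap h) := by
  obtain ⟨a, ha⟩ := exists_forall_eq_pow_of_finite_domain (ResidueField S)
  obtain ⟨x, rfl⟩ := Ideal.Quotient.mk_surjective a
  refine ⟨x, x.2.1, fun F h hxF b => ?_⟩
  by_cases hb : b = 0
  · exact ⟨0, by rw [hb, map_zero]⟩
  obtain ⟨n, rfl⟩ := ha b hb
  exact ⟨Ideal.Quotient.mk _ ⟨x, hxF, x.2.2⟩ ^ n, map_pow _ _ _⟩

theorem ramificationIndex_mul_residualDegree_le_of_commutative {F S : Subalgebra K B}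
    (hZF : subalgebraCenter S ≤ F) (hFS : F ≤ S) (hcomm : ∀ x ∈ F, ∀ y ∈ F, Commute x y) :
    ramificationIndex hZF * residualDegree hZF ≤ ramificationIndex hFS * residualDegree hFS := by
  have hle : (Module.finrank K F * Module.finrank K F : ℝ) ≤
      Module.finrank K S * Module.finrank K (subalgebraCenter S) := by
    exact_mod_cast finrank_mul_self_le_of_commutative hZF hFS hcomm
  have hpos : (0 : ℝ) < Module.finrank K F * Module.finrank K (subalgebraCenter S) := by
    exact_mod_cast Nat.mul_pos Module.finrank_pos Module.finrank_pos
  refine le_of_mul_le_mul_left ?_ hpos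
  calc _ = (Module.finrank K F * Module.finrank K F : ℝ) := by
        rw [mul_assoc, finrank_mul_ramificationIndex_mul_residualDegree]
    _ ≤ Module.finrank K S * Module.finrank K (subalgebraCenter S) := hle
    _ = _ := by
        rw [← finrank_mul_ramificationIndex_mul_residualDegree hFS]
        ring

theorem ramificationIndex_subalgebraCenter_le (S : Subalgebra K B) :
    ramificationIndex (subalgebraCenter_le S) ≤ residualDegree (subalgebraCenter_le S) := by
  obtain ⟨F, hZF, hFS, hcomm, hmem⟩ := exists_commutative_subalgebra_mem (uniformizer S).2.1
  have hle := ramificationIndex_mul_residualDegree_le_of_commutative hZF hFS hcomm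
  have he := one_le_ramificationIndex hZF
  have hf : (1 : ℝ) ≤ residualDegree hZF := by exact_mod_cast residualDegree_pos hZF
  rw [ramificationIndex_eq_one hFS hmem, one_mul] at hle
  rw [← ramificationIndex_mul hZF hFS, ramificationIndex_eq_one hFS hmem, mul_one,
    ← residualDegree_mul hZF hFS, Nat.cast_mul]
  calc ramificationIndex hZF ≤ ramificationIndex hZF * residualDegree hZF :=
        le_mul_of_one_le_right (zero_le_one.trans he) hf
    _ ≤ residualDegree hFS := hle
    _ ≤ residualDegree hZF * residualDegree hFS := le_mul_of_one_le_left (Nat.cast_nonneg _) hf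

theorem residualDegree_subalgebraCenter_le (S : Subalgebra K B) :
    residualDegree (subalgebraCenter_le S) ≤ ramificationIndex (subalgebraCenter_le S) := by
  obtain ⟨x, hxS, hx⟩ := exists_forall_residueMap_surjective_of_mem S
  obtain ⟨F, hZF, hFS, hcomm, hmem⟩ := exists_commutative_subalgebra_mem hxS
  have hle := ramificationIndex_mul_residualDegree_le_of_commutative hZF hFS hcomm
  have he := one_le_ramificationIndex hZF
  have hf : (1 : ℝ) ≤ residualDegree hZF := by exact_mod_cast residualDegree_pos hZF
  have hone := residualDegree_eq_one hFS (hx F hFS hmem)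
  rw [hone, Nat.cast_one, mul_one] at hle
  rw [← residualDegree_mul hZF hFS, hone, mul_one, ← ramificationIndex_mul hZF hFS]
  calc (residualDegree hZF : ℝ) ≤ ramificationIndex hZF * residualDegree hZF :=
        le_mul_of_one_le_left (Nat.cast_nonneg _) he
    _ ≤ ramificationIndex hFS := hle
    _ ≤ ramificationIndex hZF * ramificationIndex hFS :=
        le_mul_of_one_le_left (zero_le_one.trans (one_le_ramificationIndex hFS)) he

theorem ramificationIndex_eq_residualDegree_of_subalgebraCenter_eq {Z S : Subalgebra K B}
    (hZ : subalgebraCenter S = Z) (h : Z ≤ S) : ramificationIndex h = residualDegree h := by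
  subst hZ
  exact (ramificationIndex_subalgebraCenter_le S).antisymm (residualDegree_subalgebraCenter_le S)

theorem ramificationIndex_bot_mul_residualDegree_bot_comm {S T : Subalgebra K B}
    (hST : subalgebraCenter S = subalgebraCenter T) :
    ramificationIndex (bot_le : ⊥ ≤ S) * residualDegree (bot_le : ⊥ ≤ T) =
      ramificationIndex (bot_le : ⊥ ≤ T) * residualDegree (bot_le : ⊥ ≤ S) := by
  have hZT : subalgebraCenter S ≤ T := hST.trans_le (subalgebraCenter_le T)
  rw [← ramificationIndex_mul bot_le (subalgebraCenter_le S), ← ramificationIndex_mul bot_le hZT,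
    ← residualDegree_mul bot_le (subalgebraCenter_le S), ← residualDegree_mul bot_le hZT,
    ramificationIndex_eq_residualDegree_of_subalgebraCenter_eq rfl,
    ramificationIndex_eq_residualDegree_of_subalgebraCenter_eq hST.symm hZT]
  push_cast
  ring

end RamificationOverCenter

section CentralDivisionAlgebra

variable {K : Type*} [NontriviallyNormedField K] [IsUltrametricDist K] [LocallyCompactSpace K]
variable {B : Type*} [DivisionRing B] [Algebra K B] [FiniteDimensional K B] [Algebra.IsCentral K B]

theorem ramificationIndex_bot_top_eq_residualDegree :
    ramificationIndex (bot_le : ⊥ ≤ (⊤ : Subalgebra K B)) =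
      residualDegree (bot_le : ⊥ ≤ (⊤ : Subalgebra K B)) :=
  ramificationIndex_eq_residualDegree_of_subalgebraCenter_eq subalgebraCenter_top bot_le

theorem ramificationIndex_bot_mul_residualDegree_bot_centralizer (L : Subalgebra K B) :
    ramificationIndex (bot_le : ⊥ ≤ L) *
        residualDegree (bot_le : ⊥ ≤ Subalgebra.centralizer K (L : Set B)) =
      residualDegree (bot_le : ⊥ ≤ (⊤ : Subalgebra K B)) := by
  set C := Subalgebra.centralizer K (L : Set B)
  have hcomm := ramificationIndex_bot_mul_residualDegree_bot_comm
    (subalgebraCenter_centralizer L).symm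
  have hnonneg : 0 ≤ ramificationIndex (bot_le : ⊥ ≤ L) :=
    zero_le_one.trans (one_le_ramificationIndex _)
  have hdim : (Module.finrank K L * Module.finrank K C : ℝ) =
      Module.finrank K (⊤ : Subalgebra K B) := by
    rw [Subalgebra.topEquiv.toLinearEquiv.finrank_eq]
    exact_mod_cast finrank_mul_finrank_centralizer L
  simp only [← ramificationIndex_bot_mul_residualDegree] at hdim
  refine (mul_self_inj (mul_nonneg hnonneg (Nat.cast_nonneg _)) (Nat.cast_nonneg _)).1 ?_
  calc _ = ramificationIndex (bot_le : ⊥ ≤ L) * residualDegree (bot_le : ⊥ ≤ L) *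
        (ramificationIndex (bot_le : ⊥ ≤ C) * residualDegree (bot_le : ⊥ ≤ C)) := by
        nth_rw 2 [hcomm]
        ring
    _ = _ := by rw [hdim, ramificationIndex_bot_top_eq_residualDegree]

end CentralDivisionAlgebra

end LocalDivisionAlgebra

open LocalDivisionAlgebra

theorem mainTheorem7 {K : Type*} [NontriviallyNormedField K] [IsUltrametricDist K]
    [LocallyCompactSpace K] {B : Type*} [DivisionRing B] [Algebra K B] [FiniteDimensional K B]
    [Algebra.IsCentral K B] (L C : Subalgebra K B)
    (hC : C = Subalgebra.centralizer K (L : Set B)) :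
    LocalDivisionAlgebra.ramificationIndex (bot_le : ⊥ ≤ L) =
        LocalDivisionAlgebra.residualDegree (le_top : C ≤ ⊤) ∧
      (LocalDivisionAlgebra.residualDegree (bot_le : ⊥ ≤ L) : ℝ) =
        LocalDivisionAlgebra.ramificationIndex (le_top : C ≤ ⊤) := by
  subst hC
  set C := Subalgebra.centralizer K (L : Set B)
  have hef := ramificationIndex_bot_mul_residualDegree_bot_centralizer L
  have hfe := (ramificationIndex_bot_mul_residualDegree_bot_comm
    (subalgebraCenter_centralizer L).symm).symm.trans hef
  have he : ramificationIndex (bot_le : ⊥ ≤ C) ≠ 0 :=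
    (zero_lt_one.trans_le (one_le_ramificationIndex _)).ne'
  have hf : (residualDegree (bot_le : ⊥ ≤ C) : ℝ) ≠ 0 :=
    Nat.cast_ne_zero.2 (residualDegree_pos _).ne'
  constructor
  · refine mul_right_cancel₀ hf (hef.trans ?_)
    rw [← residualDegree_mul (bot_le : ⊥ ≤ C) le_top, Nat.cast_mul, mul_comm]
  · refine mul_left_cancel₀ he (hfe.trans ?_)
    rw [← ramificationIndex_bot_top_eq_residualDegree,
      ← ramificationIndex_mul (bot_le : ⊥ ≤ C) le_top]
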